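/- Setting (one-dimensional delegation). The type space is $S=[\underline s,\overline s]\subset\mathbb{R}$ with $\underline s<\overline s$, and actions are real numbers. The payoffs from action $a$ in state $s$ are $u_A(a,s)=as+b(a)$ for the agent and $u_P(a,s)=a\,g(s)+\kappa b(a)$ for the principal, where $\kappa>0$; $b:\mathbb{R}\to\mathbb{R}$ is strictly concave and differentiable with Lipschitz derivative and $\lim_{|a|\to\infty}b(a)/|a|=-\infty$; and $g:S\to\mathbb{R}$ is continuous on $S$ and differentiable on $(\underline s,\overline s)$. The state has a probability distribution $F$ with support $S$ and a density $f$ that is continuous on $S$ and differentiable on $(\underline s,\overline s)$. A mechanism $m$ assigns to each $s\in S$ a probability distribution over actions such that expected payoffs are integrable; it is incentive compatible if $\mathbb{E}_{m(s)}[u_A(a,s)]\ge\mathbb{E}_{m(s')}[u_A(a,s)]$ for all $s,s'\in S$, and it is optimal if it maximizes $\int \mathbb{E}_{m(s)}[u_P(a,s)]\,\mathrm dF(s)$ among all incentive-compatible mechanisms. The first-best action of a number $s\in\mathbb{R}$ is the maximizer of $as+b(a)$ over $a\in\mathbb{R}$. For closed $A\subseteq\mathbb{R}$, delegating to $A$ is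 optimal if there is an optimal mechanism in which each type in $A\cap S$ gets her first-best action for sure and every other type gets for sure her most preferred action among the first-best actions of the elements of $A$. Let \[ \nu(s)=\begin{cases} \kappa f(s)-[g'(s)-\kappa]f(s)-[g(s)-\kappa s]f'(s) & \text{if } s\in(\underline s,\overline s),\\ [g(\overline s)-\kappa\overline s]f(\overline s) & \text{if } s=\overline s,\\ [\kappa\underline s-g(\underline s)]f(\underline s) & \text{if } s=\underline s. \end{cases} \] Claim. If $\{s\in S:\nu(s)\ge 0\}$ is an interval (possibly degenerate), then there are real numbers $s_1\le s_2$ such that delegating to $[s_1,s_2]$ is optimal, where either $[s_1,s_2]\subseteq S$ or $s_1=s_2$ (in the latter case the interval consists of one point, possibly outside $S$, and all types get the same action). In particular, it is optimal to let the agent choose freely from some closed bounded interval of actions. -/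

import Mathlib

open MeasureTheory Set Filter

/-- The distribution on the type space `[lo, hi]` with Lebesgue density `f`. -/
noncomputable def stateLaw (lo hi : ℝ) (f : ℝ → ℝ) : Measure ℝ :=
  (volume.restrict (Icc lo hi)).withDensity (fun s => ENNReal.ofReal (f s))

/-- A delegation problem with one-dimensional actions and types. The type space is
`S = [lo, hi]`, an action is a real number, and the payoffs from action `a` in state `s` are
`a * s + b a` for the agent and `a * g s + κ * b a` for the principal. The functions `g` and `f`
are only relevant on `S`. -/
structure DelegationProblem where
  /-- lowest type -/
  lo : ℝ
  /-- highest type -/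
  hi : ℝ
  lo_lt_hi : lo < hi
  /-- common component of the payoffs -/
  b : ℝ → ℝ
  b_strictConcave : StrictConcaveOn ℝ univ b
  b_differentiable : Differentiable ℝ b
  b_deriv_lipschitz : ∃ K : NNReal, LipschitzWith K (deriv b)
  b_limit : Tendsto (fun a : ℝ => b a / ‖a‖) (Bornology.cobounded ℝ) atBot
  /-- weight of the common component in the principal's payoff -/
  κ : ℝ
  κ_pos : 0 < κ
  /-- state-dependent component of the principal's payoff -/
  g : ℝ → ℝ
  g_continuous : ContinuousOn g (Icc lo hi)
  g_differentiable : DifferentiableOn ℝ g (Ioo lo hi)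
  /-- density of the type -/
  f : ℝ → ℝ
  f_nonneg : ∀ s ∈ Icc lo hi, 0 ≤ f s
  f_continuous : ContinuousOn f (Icc lo hi)
  f_differentiable : DifferentiableOn ℝ f (Ioo lo hi)
  law_isProbability : IsProbabilityMeasure (stateLaw lo hi f)
  law_support : (stateLaw lo hi f).support = Icc lo hi

namespace DelegationProblem

/-- The type space. -/
def S (P : DelegationProblem) : Set ℝ := Icc P.lo P.hi

/-- The distribution of the type. -/
noncomputable def law (P : DelegationProblem) : Measure ℝ := stateLaw P.lo P.hi P.f

/-- The agent's payoff from a deterministic action. -/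
def uA (P : DelegationProblem) (a s : ℝ) : ℝ := a * s + P.b a

/-- The principal's payoff from a deterministic action. -/
def uP (P : DelegationProblem) (a s : ℝ) : ℝ := a * P.g s + P.κ * P.b a

/-- The agent's expected payoff from a lottery over actions. -/
noncomputable def agentPayoff (P : DelegationProblem) (p : ProbabilityMeasure ℝ) (s : ℝ) : ℝ :=
  ∫ a, P.uA a s ∂(p : Measure ℝ)

/-- The principal's expected payoff from a lottery over actions. -/
noncomputable def principalPayoff (P : DelegationProblem) (p : ProbabilityMeasure ℝ) (s : ℝ) : ℝ :=
  ∫ a, P.uP a s ∂(p : Measure ℝ)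

/-- `m` is a (possibly stochastic) mechanism: it assigns a lottery over actions to each type, and
expected payoffs are integrable. Only the values of `m` on the type space matter. -/
structure IsMechanism (P : DelegationProblem) (m : ℝ → ProbabilityMeasure ℝ) : Prop where
  integrable_action : ∀ s ∈ P.S, Integrable (fun a : ℝ => a) (m s : Measure ℝ)
  integrable_b : ∀ s ∈ P.S, Integrable P.b (m s : Measure ℝ)
  integrable_agent : Integrable (fun s => P.agentPayoff (m s) s) P.law
  integrable_principal : Integrable (fun s => P.principalPayoff (m s) s) P.law

/-- No type gains from pretending to be another type. -/
def IncentiveCompatible (P : DelegationProblem) (m : ℝ → ProbabilityMeasure ℝ) : Prop :=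
  ∀ s ∈ P.S, ∀ s' ∈ P.S, P.agentPayoff (m s') s ≤ P.agentPayoff (m s) s

/-- The principal's ex ante expected payoff from a mechanism. -/
noncomputable def value (P : DelegationProblem) (m : ℝ → ProbabilityMeasure ℝ) : ℝ :=
  ∫ s, P.principalPayoff (m s) s ∂P.law

/-- `m` maximizes the principal's expected payoff among all incentive-compatible mechanisms. -/
def IsOptimal (P : DelegationProblem) (m : ℝ → ProbabilityMeasure ℝ) : Prop :=
  P.IsMechanism m ∧ P.IncentiveCompatible m ∧
    ∀ m' : ℝ → ProbabilityMeasure ℝ,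
      P.IsMechanism m' → P.IncentiveCompatible m' → P.value m' ≤ P.value m

/-- `a` is a first-best action of the (possibly hypothetical) type `s`. -/
def IsFirstBest (P : DelegationProblem) (a s : ℝ) : Prop :=
  ∀ a' : ℝ, P.uA a' s ≤ P.uA a s

/-- The first-best actions of the types in `A`. -/
def menu (P : DelegationProblem) (A : Set ℝ) : Set ℝ :=
  {a | ∃ t ∈ A, P.IsFirstBest a t}

/-- The lottery that yields `a` for sure. -/
noncomputable def sure (a : ℝ) : ProbabilityMeasure ℝ := ⟨Measure.dirac a, inferInstance⟩

/-- `m` delegates to `A`: types in `A` get their first-best action, and any other type gets her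
most preferred action among the first-best actions of types in `A`. -/
def DelegatesTo (P : DelegationProblem) (A : Set ℝ) (m : ℝ → ProbabilityMeasure ℝ) : Prop :=
  (∀ s ∈ P.S, s ∈ A → ∃ a, P.IsFirstBest a s ∧ m s = sure a) ∧
  (∀ s ∈ P.S, s ∉ A →
    ∃ a ∈ P.menu A, (∀ a' ∈ P.menu A, P.uA a' s ≤ P.uA a s) ∧ m s = sure a)

/-- Delegating to `A` is optimal, among all incentive-compatible mechanisms. -/
def DelegationOptimal (P : DelegationProblem) (A : Set ℝ) : Prop :=
  ∃ m : ℝ → ProbabilityMeasure ℝ, P.IsOptimal m ∧ P.DelegatesTo A m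

/-- The weight `ν(s)` of the indirect utility of type `s ∈ S` in the principal's objective: a
density with respect to Lebesgue measure on `(lo, hi)`, and a mass at the two boundary types. -/
noncomputable def ν (P : DelegationProblem) (s : ℝ) : ℝ :=
  if s = P.lo then (P.κ * P.lo - P.g P.lo) * P.f P.lo
  else if s = P.hi then (P.g P.hi - P.κ * P.hi) * P.f P.hi
  else P.κ * P.f s - (deriv P.g s - P.κ) * P.f s - (P.g s - P.κ * s) * deriv P.f s

end DelegationProblem

/-! Under incentive compatibility the indirect utility U is convex with the mean action A as
subgradient (`IsMechanism.isSubgradientOn`), and the principal's payoff is κU + (g − κs)A.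
Integration by parts (`objective_eq`) turns her objective into κU(t) − ∫_{lo}^t N A + ∫_t^{hi} (κ −
N) A for any t, where N = `cumWeight` is the distribution function of ν. If {ν ≥ 0} is an interval,
N truncated to [0, κ] is increasing (`cumWeight_le_of_ordConnected`), so N crosses 0 and κ at most
once, each time upwards.

Let G(t) = ∫_{lo}^t N and H(t) = ∫_t^{hi} (κ − N). By `exists_pooling_or_interval` there are two
cases. If G(t), H(t) ≤ 0 for some t, Chebyshev-type bounds give the upper bound κU(t) + A(t)(H(t) −
G(t)), which a constant action attains. Otherwise G(s₁) = 0 = H(s₂) with 0 ≤ N ≤ κ on [s₁, s₂]: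
outside this interval constant actions are best, and inside it the weights on U are nonnegative, so
first-best utility is best. -/

/-! ### Subgradient selections of convex functions on an interval -/

/-- `A s` is a slope of a line supporting `U` at `s` on `[lo, hi]`, for every `s ∈ [lo, hi]`. -/
def IsSubgradientOn (U A : ℝ → ℝ) (lo hi : ℝ) : Prop :=
  ∀ s ∈ Icc lo hi, ∀ t ∈ Icc lo hi, U s + A s * (t - s) ≤ U t

namespace IsSubgradientOn

variable {U A : ℝ → ℝ} {lo hi : ℝ}

theorem monotoneOn (h : IsSubgradientOn U A lo hi) : MonotoneOn A (Icc lo hi) := by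
  intro s hs t ht hst
  rcases hst.eq_or_lt with rfl | hlt
  · exact le_rfl
  · have h1 := h s hs t ht
    have h2 := h t ht s hs
    by_contra hc
    push Not at hc
    nlinarith [mul_pos (sub_pos.2 hlt) (sub_pos.2 hc)]

theorem mono (h : IsSubgradientOn U A lo hi) {x y : ℝ} (hx : lo ≤ x) (hy : y ≤ hi) :
    IsSubgradientOn U A x y := fun s hs t ht =>
  h s ⟨hx.trans hs.1, hs.2.trans hy⟩ t ⟨hx.trans ht.1, ht.2.trans hy⟩

theorem intervalIntegrable (h : IsSubgradientOn U A lo hi) {x y : ℝ} (hx : lo ≤ x) (hxy : x ≤ y)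
    (hy : y ≤ hi) : IntervalIntegrable A volume x y := by
  apply MonotoneOn.intervalIntegrable
  rw [uIcc_of_le hxy]
  exact (h.mono hx hy).monotoneOn

/-- Monotone slopes are bounded by their endpoint values, so U is Lipschitz. Convexity alone would
not give continuity at the endpoints. -/
theorem continuousOn (h : IsSubgradientOn U A lo hi) : ContinuousOn U (Icc lo hi) := by
  rcases lt_or_ge hi lo with hlt | hle
  · simp [Icc_eq_empty hlt.not_ge]
  have hlo : lo ∈ Icc lo hi := ⟨le_rfl, hle⟩
  have hhi : hi ∈ Icc lo hi := ⟨hle, le_rfl⟩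
  set K : ℝ := max |A lo| |A hi| with hK
  have hA : ∀ s ∈ Icc lo hi, |A s| ≤ K := fun s hs =>
    abs_le_max_abs_abs (h.monotoneOn hlo hs hs.1) (h.monotoneOn hs hhi hs.2)
  have hK0 : 0 ≤ K := (abs_nonneg _).trans (hA lo hlo)
  have hlip : LipschitzOnWith K.toNNReal U (Icc lo hi) := by
    apply LipschitzOnWith.of_le_add_mul
    intro s hs t ht
    rw [Real.coe_toNNReal _ hK0, Real.dist_eq]
    have h1 := h s hs t ht
    have h2 : -(A s * (t - s)) ≤ K * |s - t| := by
      calc -(A s * (t - s)) = A s * (s - t) := by ring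
        _ ≤ |A s * (s - t)| := le_abs_self _
        _ = |A s| * |s - t| := abs_mul _ _
        _ ≤ K * |s - t| := by gcongr; exact hA s hs
    linarith
  exact hlip.continuousOn

theorem convexOn (h : IsSubgradientOn U A lo hi) : ConvexOn ℝ (Icc lo hi) U := by
  refine ⟨convex_Icc _ _, fun x hx y hy a b ha hb hab => ?_⟩
  have hz := (convex_Icc lo hi) hx hy ha hb hab
  have h1 := h _ hz x hx
  have h2 := h _ hz y hy
  simp only [smul_eq_mul] at *
  set z := a * x + b * y
  have hz' : a * (x - z) + b * (y - z) = 0 := by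
    have : a * (x - z) + b * (y - z) = z - (a + b) * z := by simp only [z]; ring
    rw [this, hab]; ring
  have h3 := mul_le_mul_of_nonneg_left h1 ha
  have h4 := mul_le_mul_of_nonneg_left h2 hb
  have h5 : a * (U z + A z * (x - z)) + b * (U z + A z * (y - z))
      = (a + b) * U z + A z * (a * (x - z) + b * (y - z)) := by ring
  rw [hz', hab] at h5
  linarith

theorem hasDerivWithinAt_rightDeriv (h : IsSubgradientOn U A lo hi) {s : ℝ} (hs : s ∈ Ioo lo hi) :
    HasDerivWithinAt U (derivWithin U (Ioi s) s) (Ioi s) s :=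
  h.convexOn.hasDerivWithinAt_rightDeriv_of_mem_interior (by rwa [interior_Icc])

/-- The support inequalities at s and t squeeze U(t) − U(s) − A(s)(t − s) between 0 and (A(t) −
A(s))(t − s). -/
theorem hasDerivAt_of_continuousAt (h : IsSubgradientOn U A lo hi) {s : ℝ} (hs : s ∈ Ioo lo hi)
    (hA : ContinuousAt A s) : HasDerivAt U (A s) s := by
  rw [hasDerivAt_iff_isLittleO, Asymptotics.isLittleO_iff]
  intro c hc
  have h1 := Metric.continuousAt_iff'.1 hA c hc
  filter_upwards [h1, Ioo_mem_nhds hs.1 hs.2] with t ht hts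
  have hs' := Ioo_subset_Icc_self hs
  have ht' := Ioo_subset_Icc_self hts
  have h2 := h s hs' t ht'
  have h3 := h t ht' s hs'
  rw [Real.dist_eq] at ht
  simp only [smul_eq_mul, Real.norm_eq_abs]
  have h4 : 0 ≤ U t - U s - (t - s) * A s := by linarith
  rw [abs_of_nonneg h4]
  calc U t - U s - (t - s) * A s ≤ (A t - A s) * (t - s) := by linarith
    _ ≤ |(A t - A s) * (t - s)| := le_abs_self _
    _ = |A t - A s| * |t - s| := abs_mul _ _
    _ ≤ c * |t - s| := by gcongr

/-- A monotone function has countably many discontinuities. The right derivative can thus replace A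
under integrals; it is a genuine one-sided derivative at every interior point, as the fundamental
theorem requires. -/
theorem ae_rightDeriv_eq (h : IsSubgradientOn U A lo hi) :
    ∀ᵐ s, s ∈ Icc lo hi → derivWithin U (Ioi s) s = A s := by
  have hc := h.monotoneOn.countable_not_continuousWithinAt
  have hc' : ({s ∈ Icc lo hi | ¬ContinuousWithinAt A (Icc lo hi) s} ∪ {lo, hi}).Countable :=
    hc.union ((countable_singleton hi).insert lo)
  filter_upwards [hc'.ae_notMem volume] with s hs hsI
  simp only [mem_union, mem_insert_iff, mem_singleton_iff, not_or] at hs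
  have hsO : s ∈ Ioo lo hi :=
    ⟨lt_of_le_of_ne hsI.1 (Ne.symm hs.2.1), lt_of_le_of_ne hsI.2 hs.2.2⟩
  have hcont : ContinuousAt A s := by
    by_contra hn
    exact hs.1 ⟨hsI, fun hw => hn (hw.continuousAt (Icc_mem_nhds hsO.1 hsO.2))⟩
  exact (h.hasDerivAt_of_continuousAt hsO hcont).hasDerivWithinAt.derivWithin
    (uniqueDiffWithinAt_Ioi s)

theorem ae_restrict_rightDeriv_eq (h : IsSubgradientOn U A lo hi) {x y : ℝ} (hx : lo ≤ x)
    (hxy : x ≤ y) (hy : y ≤ hi) :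
    (fun s => derivWithin U (Ioi s) s) =ᵐ[volume.restrict (uIoc x y)] A := by
  rw [EventuallyEq, ae_restrict_iff' measurableSet_uIoc]
  filter_upwards [h.ae_rightDeriv_eq] with s hs hsI
  rw [uIoc_of_le hxy] at hsI
  exact hs ⟨hx.trans hsI.1.le, hsI.2.trans hy⟩

theorem intervalIntegrable_rightDeriv (h : IsSubgradientOn U A lo hi) {x y : ℝ} (hx : lo ≤ x)
    (hxy : x ≤ y) (hy : y ≤ hi) :
    IntervalIntegrable (fun s => derivWithin U (Ioi s) s) volume x y :=
  (h.intervalIntegrable hx hxy hy).congr_ae (h.ae_restrict_rightDeriv_eq hx hxy hy).symm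

/-- Integration by parts against an indirect utility. -/
theorem integral_mul_eq (h : IsSubgradientOn U A lo hi) {x y : ℝ} (hx : lo ≤ x)
    (hxy : x ≤ y) (hy : y ≤ hi) {φ φ' : ℝ → ℝ} (hφ : ContinuousOn φ (Icc x y))
    (hφ' : ∀ s ∈ Ioo x y, HasDerivAt φ (φ' s) s) (hint : IntervalIntegrable φ' volume x y) :
    ∫ s in x..y, φ s * A s = φ y * U y - φ x * U x - ∫ s in x..y, φ' s * U s := by
  have hsub : Icc x y ⊆ Icc lo hi := Icc_subset_Icc hx hy
  rw [← intervalIntegral.integral_mul_deriv_eq_deriv_mul_of_hasDeriv_right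
    (v' := fun s => derivWithin U (Ioi s) s)
    (by rwa [uIcc_of_le hxy]) (by rw [uIcc_of_le hxy]; exact h.continuousOn.mono hsub)
    (by
      rw [min_eq_left hxy, max_eq_right hxy]
      exact fun s hs => (hφ' s hs).hasDerivWithinAt)
    (by
      rw [min_eq_left hxy, max_eq_right hxy]
      exact fun s hs => h.hasDerivWithinAt_rightDeriv (Ioo_subset_Ioo hx hy hs))
    hint (h.intervalIntegrable_rightDeriv hx hxy hy)]
  apply intervalIntegral.integral_congr_ae_restrict
  filter_upwards [h.ae_restrict_rightDeriv_eq hx hxy hy] with s hs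
  rw [hs]

theorem integral_eq_sub (h : IsSubgradientOn U A lo hi) {x y : ℝ} (hx : lo ≤ x)
    (hxy : x ≤ y) (hy : y ≤ hi) : ∫ s in x..y, A s = U y - U x := by
  have := h.integral_mul_eq hx hxy hy (φ := fun _ => 1) (φ' := fun _ => 0) continuousOn_const
    (fun s _ => hasDerivAt_const s 1) intervalIntegrable_const
  simpa using this

/-- If `U ≤ V` on `[x, y]`, then a nonnegative decreasing weight gives the slopes of `V - U` at
least the boundary contribution. -/
theorem boundary_le_integral {V B : ℝ → ℝ} (h : IsSubgradientOn U A lo hi)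
    (hV : IsSubgradientOn V B lo hi) {x y : ℝ} (hx : lo ≤ x) (hxy : x ≤ y) (hy : y ≤ hi)
    (hUV : ∀ s ∈ Ioo x y, U s ≤ V s) {φ φ' : ℝ → ℝ} (hφ : ContinuousOn φ (Icc x y))
    (hφ' : ∀ s ∈ Ioo x y, HasDerivAt φ (φ' s) s) (hneg : ∀ s ∈ Ioo x y, φ' s ≤ 0) :
    φ y * (V y - U y) - φ x * (V x - U x) ≤
      (∫ s in x..y, φ s * B s) - ∫ s in x..y, φ s * A s := by
  have hsub : Icc x y ⊆ Icc lo hi := Icc_subset_Icc hx hy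
  have hint : ∀ {W C : ℝ → ℝ}, IsSubgradientOn W C lo hi →
      IntervalIntegrable (fun s => φ s * C s) volume x y := fun hW =>
    (hW.intervalIntegrable hx hxy hy).continuousOn_mul (by rwa [uIcc_of_le hxy])
  have hint' : ∀ {W C : ℝ → ℝ}, IsSubgradientOn W C lo hi →
      IntervalIntegrable (fun s => φ s * derivWithin W (Ioi s) s) volume x y := fun hW =>
    (hW.intervalIntegrable_rightDeriv hx hxy hy).continuousOn_mul (by rwa [uIcc_of_le hxy])
  -- The derivative of φ(V − U) is at most φ(V' − U'), since φ'(V − U) ≤ 0. The inequality form of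
  -- the fundamental theorem needs no integrability of φ'.
  have key := intervalIntegral.sub_le_integral_of_hasDeriv_right_of_le hxy
    (g := fun s => φ s * (V s - U s))
    (g' := fun s => φ' s * (V s - U s) +
      φ s * (derivWithin V (Ioi s) s - derivWithin U (Ioi s) s))
    (φ := fun s => φ s * derivWithin V (Ioi s) s - φ s * derivWithin U (Ioi s) s)
    (hφ.mul ((hV.continuousOn.mono hsub).sub (h.continuousOn.mono hsub)))
    (fun s hs => (hφ' s hs).hasDerivWithinAt.mul
      ((hV.hasDerivWithinAt_rightDeriv (Ioo_subset_Ioo hx hy hs)).sub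
        (h.hasDerivWithinAt_rightDeriv (Ioo_subset_Ioo hx hy hs))))
    (by
      rw [integrableOn_Icc_iff_integrableOn_Ioc, ← intervalIntegrable_iff_integrableOn_Ioc_of_le hxy]
      exact (hint' hV).sub (hint' h))
    (fun s hs => by
      have := mul_nonpos_of_nonpos_of_nonneg (hneg s hs) (sub_nonneg.2 (hUV s hs))
      linarith)
  refine key.trans_eq ?_
  rw [intervalIntegral.integral_sub (hint' hV) (hint' h)]
  congr 1
  · apply intervalIntegral.integral_congr_ae_restrict
    filter_upwards [hV.ae_restrict_rightDeriv_eq hx hxy hy] with s hs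
    rw [hs]
  · apply intervalIntegral.integral_congr_ae_restrict
    filter_upwards [h.ae_restrict_rightDeriv_eq hx hxy hy] with s hs
    rw [hs]

end IsSubgradientOn

/-! ### A Chebyshev-type inequality -/

/-- A Chebyshev-type inequality for a weight that changes sign once, from `-` to `+`. -/
theorem mul_integral_le_of_sign_change {A n : ℝ → ℝ} {x y p : ℝ} (hxy : x ≤ y) (hp : p ∈ Icc x y)
    (hA : MonotoneOn A (Icc x y)) (hn : ContinuousOn n (Icc x y))
    (hneg : ∀ s ∈ Icc x y, s < p → n s ≤ 0) (hpos : ∀ s ∈ Icc x y, p < s → 0 ≤ n s) :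
    A p * ∫ s in x..y, n s ≤ ∫ s in x..y, n s * A s := by
  have hn' : ContinuousOn n (uIcc x y) := by rwa [uIcc_of_le hxy]
  have hAint : IntervalIntegrable A volume x y :=
    MonotoneOn.intervalIntegrable (by rwa [uIcc_of_le hxy])
  rw [← intervalIntegral.integral_const_mul]
  -- Pointwise, n(s)(A(s) − A(p)) ≥ 0, because both factors change sign at p in the same direction.
  refine intervalIntegral.integral_mono_on hxy (hn'.intervalIntegrable.const_mul _)
    (hAint.continuousOn_mul hn') fun s hs => ?_
  rcases lt_trichotomy s p with hsp | rfl | hsp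
  · nlinarith [hneg s hs hsp, hA hs hp hsp.le]
  · rw [mul_comm]
  · nlinarith [hpos s hs hsp, hA hp hs hsp.le]

/-! ### The cumulative weight and the principal's objective -/

namespace DelegationProblem

variable (P : DelegationProblem)

/-- The part of the principal's payoff density that multiplies the action once the common
component has been expressed through the agent's payoff. -/
noncomputable def biasDensity (s : ℝ) : ℝ := (P.g s - P.κ * s) * P.f s

/-- The cumulative weight that `ν` puts on the types up to `s < hi`. -/
noncomputable def cumWeight (s : ℝ) : ℝ := P.κ * (∫ x in P.lo..s, P.f x) - P.biasDensity s

theorem lo_mem : P.lo ∈ P.S := ⟨le_rfl, P.lo_lt_hi.le⟩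

theorem hi_mem : P.hi ∈ P.S := ⟨P.lo_lt_hi.le, le_rfl⟩

theorem f_intervalIntegrable {x y : ℝ} (hx : x ∈ P.S) (hy : y ∈ P.S) :
    IntervalIntegrable P.f volume x y :=
  (P.f_continuous.mono (uIcc_subset_Icc hx hy)).intervalIntegrable

theorem aemeasurable_density :
    AEMeasurable (fun s => ENNReal.ofReal (P.f s)) (volume.restrict (Icc P.lo P.hi)) :=
  (P.f_continuous.aemeasurable measurableSet_Icc).ennreal_ofReal

theorem integral_law (φ : ℝ → ℝ) : ∫ s, φ s ∂P.law = ∫ s in P.lo..P.hi, P.f s * φ s := by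
  rw [law, stateLaw, integral_withDensity_eq_integral_toReal_smul₀ P.aemeasurable_density
    (ae_of_all _ fun _ => ENNReal.ofReal_lt_top),
    intervalIntegral.integral_of_le P.lo_lt_hi.le, ← integral_Icc_eq_integral_Ioc]
  refine setIntegral_congr_fun measurableSet_Icc fun s hs => ?_
  simp [ENNReal.toReal_ofReal (P.f_nonneg s hs)]

theorem integrable_law {φ : ℝ → ℝ} (hφ : IntervalIntegrable φ volume P.lo P.hi) :
    Integrable φ P.law := by
  rw [law, stateLaw, integrable_withDensity_iff_integrable_smul₀' P.aemeasurable_density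
    (ae_of_all _ fun _ => ENNReal.ofReal_lt_top)]
  have h1 : IntervalIntegrable (fun s => P.f s * φ s) volume P.lo P.hi :=
    hφ.continuousOn_mul (by rw [uIcc_of_le P.lo_lt_hi.le]; exact P.f_continuous)
  rw [intervalIntegrable_iff_integrableOn_Ioc_of_le P.lo_lt_hi.le,
    ← integrableOn_Icc_iff_integrableOn_Ioc] at h1
  refine h1.congr_fun (fun s hs => ?_) measurableSet_Icc
  simp [ENNReal.toReal_ofReal (P.f_nonneg s hs)]

theorem integral_f : ∫ s in P.lo..P.hi, P.f s = 1 := by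
  have : IsProbabilityMeasure P.law := P.law_isProbability
  have h := P.integral_law fun _ => 1
  simpa using h.symm

theorem biasDensity_continuousOn : ContinuousOn P.biasDensity P.S :=
  (P.g_continuous.sub (continuousOn_const.mul continuousOn_id)).mul P.f_continuous

theorem integral_f_continuousOn : ContinuousOn (fun s => ∫ x in P.lo..s, P.f x) P.S := by
  have h := intervalIntegral.continuousOn_primitive_interval'
    (P.f_intervalIntegrable P.lo_mem P.hi_mem) left_mem_uIcc
  rwa [uIcc_of_le P.lo_lt_hi.le] at h

theorem cumWeight_continuousOn : ContinuousOn P.cumWeight P.S :=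
  (continuousOn_const.mul P.integral_f_continuousOn).sub P.biasDensity_continuousOn

theorem hasDerivAt_integral_f {s : ℝ} (hs : s ∈ Ioo P.lo P.hi) :
    HasDerivAt (fun s => ∫ x in P.lo..s, P.f x) (P.f s) s := by
  have hnhds := isOpen_Ioo.mem_nhds hs
  refine intervalIntegral.integral_hasDerivAt_right
    (P.f_intervalIntegrable P.lo_mem (Ioo_subset_Icc_self hs)) ?_
    ((P.f_continuous.mono Ioo_subset_Icc_self).continuousAt hnhds)
  exact (P.f_continuous.mono Ioo_subset_Icc_self).stronglyMeasurableAtFilter isOpen_Ioo s hs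

theorem hasDerivAt_cumWeight {s : ℝ} (hs : s ∈ Ioo P.lo P.hi) :
    HasDerivAt P.cumWeight (P.ν s) s := by
  have hnhds := isOpen_Ioo.mem_nhds hs
  have hg := (P.g_differentiable.differentiableAt hnhds).hasDerivAt
  have hf := (P.f_differentiable.differentiableAt hnhds).hasDerivAt
  have h := ((P.hasDerivAt_integral_f hs).const_mul P.κ).sub
    ((hg.sub ((hasDerivAt_id s).const_mul P.κ)).mul hf)
  refine h.congr_deriv ?_
  simp only [ν, hs.1.ne', hs.2.ne, if_false, id, Pi.sub_apply]
  ring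

theorem cumWeight_lo : P.cumWeight P.lo = P.ν P.lo := by
  simp [cumWeight, biasDensity, ν]
  ring

/-- The atom at the top type is not included in `cumWeight`; adding it brings the total mass of ν to
κ. -/
theorem cumWeight_hi : P.cumWeight P.hi = P.κ - P.ν P.hi := by
  simp [cumWeight, biasDensity, ν, P.lo_lt_hi.ne', P.integral_f]

/-- If the weights are nonnegative exactly on an interval, then the cumulative weight, truncated
to `[0, κ]`, is increasing. -/
theorem cumWeight_le_of_ordConnected (hν : OrdConnected {s : ℝ | s ∈ P.S ∧ 0 ≤ P.ν s}) {x y : ℝ}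
    (hx : x ∈ P.S) (hy : y ∈ P.S) (hxy : x ≤ y) (hx0 : 0 < P.cumWeight x)
    (hyκ : P.cumWeight y < P.κ) : P.cumWeight x ≤ P.cumWeight y := by
  rcases hxy.eq_or_lt with rfl | hlt
  · exact le_rfl
  by_contra hc
  push Not at hc
  have hsub : Icc x y ⊆ P.S := Icc_subset_Icc hx.1 hy.2
  -- If N falls from x to y, the mean value theorem yields z in between with ν(z) < 0.
  obtain ⟨z, hz, hz'⟩ := exists_hasDerivAt_eq_slope P.cumWeight P.ν hlt
    (P.cumWeight_continuousOn.mono hsub)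
    fun s hs => P.hasDerivAt_cumWeight ⟨hx.1.trans_lt hs.1, hs.2.trans_le hy.2⟩
  have hzneg : P.ν z < 0 := by
    rw [hz']
    exact div_neg_of_neg_of_pos (by linarith) (by linarith)
  have hzS : z ∈ Ioo P.lo P.hi := ⟨hx.1.trans_lt hz.1, hz.2.trans_le hy.2⟩
  have hanti : ∀ {u v : ℝ}, u ∈ P.S → v ∈ P.S → (∀ s ∈ Ioo u v, P.ν s < 0) →
      AntitoneOn P.cumWeight (Icc u v) := by
    intro u v hu hv hneg
    apply antitoneOn_of_deriv_nonpos (convex_Icc u v)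
      (P.cumWeight_continuousOn.mono (Icc_subset_Icc hu.1 hv.2))
    · rw [interior_Icc]
      exact fun s hs => (P.hasDerivAt_cumWeight
        ⟨hu.1.trans_lt hs.1, hs.2.trans_le hv.2⟩).differentiableAt.differentiableWithinAt
    · rw [interior_Icc]
      intro s hs
      rw [(P.hasDerivAt_cumWeight ⟨hu.1.trans_lt hs.1, hs.2.trans_le hv.2⟩).deriv]
      exact (hneg s hs).le
  -- As {ν ≥ 0} is an interval missing z, ν is negative on one whole side of z. On the left this
  -- gives N(x) ≤ N(lo) = ν(lo) < 0; on the right, N(y) ≥ N(hi) = κ − ν(hi) > κ.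
  have hside : (∀ s ∈ P.S, s ≤ z → P.ν s < 0) ∨ (∀ s ∈ P.S, z ≤ s → P.ν s < 0) := by
    by_contra hcon
    push Not at hcon
    obtain ⟨⟨u, hu, huz, hu0⟩, v, hv, hvz, hv0⟩ := hcon
    exact absurd (hν.out ⟨hu, hu0⟩ ⟨hv, hv0⟩ ⟨huz, hvz⟩).2 hzneg.not_ge
  rcases hside with hL | hR
  · have h1 := hanti P.lo_mem hx fun s hs =>
      hL s ⟨hs.1.le, hs.2.le.trans hx.2⟩ (hs.2.le.trans hz.1.le)
    have h2 := h1 ⟨le_rfl, hx.1⟩ ⟨hx.1, le_rfl⟩ hx.1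
    have h3 := hL P.lo P.lo_mem hzS.1.le
    rw [P.cumWeight_lo] at h2
    linarith
  · have h1 := hanti hy P.hi_mem fun s hs =>
      hR s ⟨hy.1.trans hs.1.le, hs.2.le⟩ (hz.2.le.trans hs.1.le)
    have h2 := h1 ⟨le_rfl, hy.2⟩ ⟨hy.2, le_rfl⟩ hy.2
    have h3 := hR P.hi P.hi_mem hzS.2.le
    rw [P.cumWeight_hi] at h2
    linarith

/-- The principal's objective in terms of the agent's indirect utility `U` and expected
action `A`. -/
noncomputable def objective (U A : ℝ → ℝ) : ℝ :=
  ∫ s in P.lo..P.hi, P.f s * (P.κ * U s + (P.g s - P.κ * s) * A s)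

theorem cumWeight_mul_intervalIntegrable {U A : ℝ → ℝ} (h : IsSubgradientOn U A P.lo P.hi)
    {x y : ℝ} (hx : x ∈ P.S) (hy : y ∈ P.S) (hxy : x ≤ y) :
    IntervalIntegrable (fun s => P.cumWeight s * A s) volume x y :=
  (h.intervalIntegrable hx.1 hxy hy.2).continuousOn_mul
    (P.cumWeight_continuousOn.mono (uIcc_subset_Icc hx hy))

/-- Integrating fU by parts gives κU(hi) − ∫ N A; substituting U(hi) = U(t) + ∫_t^{hi} A recentres
this at t. -/
theorem objective_eq {U A : ℝ → ℝ} (h : IsSubgradientOn U A P.lo P.hi) {t : ℝ} (ht : t ∈ P.S) :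
    P.objective U A = P.κ * U t - (∫ s in P.lo..t, P.cumWeight s * A s) +
      ∫ s in t..P.hi, (P.κ - P.cumWeight s) * A s := by
  have hle := P.lo_lt_hi.le
  have hu : uIcc P.lo P.hi = P.S := uIcc_of_le hle
  have hA := h.intervalIntegrable le_rfl hle le_rfl
  have hFA : IntervalIntegrable (fun s => (∫ x in P.lo..s, P.f x) * A s) volume P.lo P.hi :=
    hA.continuousOn_mul (hu ▸ P.integral_f_continuousOn)
  have hhA : IntervalIntegrable (fun s => P.biasDensity s * A s) volume P.lo P.hi :=
    hA.continuousOn_mul (hu ▸ P.biasDensity_continuousOn)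
  have hfU : IntervalIntegrable (fun s => P.f s * U s) volume P.lo P.hi := by
    apply ContinuousOn.intervalIntegrable
    rw [hu]
    exact P.f_continuous.mul h.continuousOn
  have hparts := h.integral_mul_eq le_rfl hle le_rfl P.integral_f_continuousOn
    (fun s hs => P.hasDerivAt_integral_f hs) (P.f_intervalIntegrable P.lo_mem P.hi_mem)
  simp only [P.integral_f, intervalIntegral.integral_same] at hparts
  have h1 : P.objective U A = P.κ * (∫ s in P.lo..P.hi, P.f s * U s) +
      ∫ s in P.lo..P.hi, P.biasDensity s * A s := by
    rw [objective, ← intervalIntegral.integral_const_mul,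
      ← intervalIntegral.integral_add (hfU.const_mul _) hhA]
    refine intervalIntegral.integral_congr fun s _ => ?_
    simp only [biasDensity]
    ring
  have h2 : ∫ s in P.lo..P.hi, P.cumWeight s * A s =
      P.κ * (∫ s in P.lo..P.hi, (∫ x in P.lo..s, P.f x) * A s) -
        ∫ s in P.lo..P.hi, P.biasDensity s * A s := by
    rw [← intervalIntegral.integral_const_mul,
      ← intervalIntegral.integral_sub (hFA.const_mul _) hhA]
    refine intervalIntegral.integral_congr fun s _ => ?_
    simp only [cumWeight]
    ring
  have hNt := P.cumWeight_mul_intervalIntegrable h ht P.hi_mem ht.2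
  have h3 := intervalIntegral.integral_add_adjacent_intervals
    (P.cumWeight_mul_intervalIntegrable h P.lo_mem ht ht.1) hNt
  have h4 : ∫ s in t..P.hi, (P.κ - P.cumWeight s) * A s =
      P.κ * (U P.hi - U t) - ∫ s in t..P.hi, P.cumWeight s * A s := by
    rw [← h.integral_eq_sub ht.1 ht.2 le_rfl, ← intervalIntegral.integral_const_mul,
      ← intervalIntegral.integral_sub ((h.intervalIntegrable ht.1 ht.2 le_rfl).const_mul _) hNt]
    refine intervalIntegral.integral_congr fun s _ => ?_
    ring
  rw [h1, h4]
  linear_combination P.κ * hparts + h2 + h3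

end DelegationProblem

/-! ### Single crossing, the dichotomy, and bounds on the objective -/

theorem exists_sign_change {n : ℝ → ℝ} {lo hi : ℝ} (hle : lo ≤ hi)
    (hn : ∀ x ∈ Icc lo hi, ∀ y ∈ Icc lo hi, x ≤ y → 0 < n x → 0 ≤ n y) :
    ∃ p ∈ Icc lo hi, (∀ s ∈ Icc lo hi, s < p → n s ≤ 0) ∧ ∀ s ∈ Icc lo hi, p < s → 0 ≤ n s := by
  -- The crossing point is the supremum of the negative points; `lo` is inserted in case there are
  -- none.
  set T : Set ℝ := insert lo {s ∈ Icc lo hi | n s < 0} with hT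
  have hne : T.Nonempty := insert_nonempty _ _
  have hTsub : T ⊆ Icc lo hi := insert_subset ⟨le_rfl, hle⟩ (sep_subset _ _)
  have hbdd : BddAbove T := bddAbove_Icc.mono hTsub
  refine ⟨sSup T, ⟨le_csSup hbdd (mem_insert _ _), csSup_le hne fun s hs => (hTsub hs).2⟩,
    fun s hs hsp => ?_, fun s hs hsp => ?_⟩
  · obtain ⟨u, hu, hsu⟩ := exists_lt_of_lt_csSup hne hsp
    rcases hu with rfl | ⟨huI, hu0⟩
    · exact absurd hs.1 hsu.not_ge
    · by_contra hc
      exact absurd (hn s hs u huI hsu.le (not_le.1 hc)) hu0.not_ge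
  · by_contra hc
    exact absurd (le_csSup hbdd (mem_insert_of_mem lo ⟨hs, not_le.1 hc⟩)) hsp.not_ge

namespace DelegationProblem

variable (P : DelegationProblem)

/-- The first-order effect of the weights on the types up to `t`. -/
noncomputable def leftWeight (t : ℝ) : ℝ := ∫ s in P.lo..t, P.cumWeight s

/-- The first-order effect of the weights on the types from `t` on. -/
noncomputable def rightWeight (t : ℝ) : ℝ := ∫ s in t..P.hi, (P.κ - P.cumWeight s)

/-- The cumulative weight truncated to `[0, κ]` is increasing. -/
def TruncatedMonotone : Prop :=
  ∀ x ∈ P.S, ∀ y ∈ P.S, x ≤ y → 0 < P.cumWeight x → P.cumWeight y < P.κ →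
    P.cumWeight x ≤ P.cumWeight y

theorem cumWeight_intervalIntegrable {x y : ℝ} (hx : x ∈ P.S) (hy : y ∈ P.S) :
    IntervalIntegrable P.cumWeight volume x y :=
  (P.cumWeight_continuousOn.mono (uIcc_subset_Icc hx hy)).intervalIntegrable

theorem leftWeight_continuousOn : ContinuousOn P.leftWeight P.S := by
  have h := intervalIntegral.continuousOn_primitive_interval'
    (P.cumWeight_intervalIntegrable P.lo_mem P.hi_mem) left_mem_uIcc
  rwa [uIcc_of_le P.lo_lt_hi.le] at h

theorem rightWeight_continuousOn : ContinuousOn P.rightWeight P.S := by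
  have h := intervalIntegral.continuousOn_primitive_interval_left
    (f := fun s => P.κ - P.cumWeight s) (μ := volume) (a := P.lo) (b := P.hi) (by
      rw [uIcc_of_le P.lo_lt_hi.le]
      exact (continuousOn_const.sub P.cumWeight_continuousOn).integrableOn_Icc)
  rwa [uIcc_of_le P.lo_lt_hi.le] at h

namespace TruncatedMonotone

variable {P}

theorem exists_nonpos_nonneg (h : P.TruncatedMonotone) :
    ∃ p ∈ P.S, (∀ s ∈ P.S, s < p → P.cumWeight s ≤ 0) ∧
      ∀ s ∈ P.S, p < s → 0 ≤ P.cumWeight s := by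
  refine exists_sign_change P.lo_lt_hi.le fun x hx y hy hxy h0 => ?_
  by_contra hc
  push Not at hc
  linarith [h x hx y hy hxy h0 (hc.trans P.κ_pos)]

theorem exists_le_ge (h : P.TruncatedMonotone) :
    ∃ q ∈ P.S, (∀ s ∈ P.S, s < q → P.cumWeight s ≤ P.κ) ∧
      ∀ s ∈ P.S, q < s → P.κ ≤ P.cumWeight s := by
  obtain ⟨q, hq, h1, h2⟩ := exists_sign_change (n := fun s => P.cumWeight s - P.κ)
    P.lo_lt_hi.le fun x hx y hy hxy h0 => by
      by_contra hc
      push Not at hc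
      linarith [h x hx y hy hxy (by linarith [P.κ_pos]) (by linarith)]
  exact ⟨q, hq, fun s hs hsq => sub_nonpos.1 (h1 s hs hsq),
    fun s hs hsq => sub_nonneg.1 (h2 s hs hsq)⟩

/-- Chebyshev gives the bound with the slope at the crossing point of N (capped at t). Passing to
the larger slope A(t) only weakens it, as G(t) ≤ 0. -/
theorem mul_leftWeight_le (h : P.TruncatedMonotone) {A : ℝ → ℝ} (hA : MonotoneOn A P.S) {t : ℝ}
    (ht : t ∈ P.S) (hG : P.leftWeight t ≤ 0) :
    A t * P.leftWeight t ≤ ∫ s in P.lo..t, P.cumWeight s * A s := by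
  obtain ⟨p, hp, hneg, hpos⟩ := h.exists_nonpos_nonneg
  have hsub : Icc P.lo t ⊆ P.S := Icc_subset_Icc le_rfl ht.2
  have hp' : min p t ∈ Icc P.lo t := ⟨le_min hp.1 ht.1, min_le_right _ _⟩
  have key := mul_integral_le_of_sign_change ht.1 hp' (hA.mono hsub)
    (P.cumWeight_continuousOn.mono hsub)
    (fun s hs hsp => hneg s (hsub hs) (hsp.trans_le (min_le_left _ _)))
    (fun s hs hsp => by
      rcases min_lt_iff.1 hsp with h1 | h1
      · exact hpos s (hsub hs) h1
      · exact absurd hs.2 h1.not_ge)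
  exact (mul_le_mul_of_nonpos_right (hA (hsub hp') ht (min_le_right _ _)) hG).trans key

theorem integral_le_mul_rightWeight (h : P.TruncatedMonotone) {A : ℝ → ℝ} (hA : MonotoneOn A P.S)
    {t : ℝ} (ht : t ∈ P.S) (hH : P.rightWeight t ≤ 0) :
    ∫ s in t..P.hi, (P.κ - P.cumWeight s) * A s ≤ A t * P.rightWeight t := by
  obtain ⟨q, hq, hneg, hpos⟩ := h.exists_le_ge
  have hsub : Icc t P.hi ⊆ P.S := Icc_subset_Icc ht.1 le_rfl
  have hq' : max q t ∈ Icc t P.hi := ⟨le_max_right _ _, max_le hq.2 ht.2⟩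
  have key := mul_integral_le_of_sign_change (n := fun s => P.cumWeight s - P.κ) ht.2 hq'
    (hA.mono hsub) ((P.cumWeight_continuousOn.mono hsub).sub continuousOn_const)
    (fun s hs hsq => by
      rcases lt_max_iff.1 hsq with h1 | h1
      · exact sub_nonpos.2 (hneg s (hsub hs) h1)
      · exact absurd hs.1 h1.not_ge)
    (fun s hs hsq => sub_nonneg.2 (hpos s (hsub hs) ((le_max_left _ _).trans_lt hsq)))
  have e1 : ∫ s in t..P.hi, (P.cumWeight s - P.κ) = -P.rightWeight t := by
    rw [rightWeight, ← intervalIntegral.integral_neg]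
    simp
  have e2 : ∫ s in t..P.hi, (P.cumWeight s - P.κ) * A s =
      -∫ s in t..P.hi, (P.κ - P.cumWeight s) * A s := by
    rw [← intervalIntegral.integral_neg]
    refine intervalIntegral.integral_congr fun s _ => ?_
    ring
  rw [e1, e2] at key
  have := mul_le_mul_of_nonpos_right (hA ht (hsub hq') (le_max_right _ _)) hH
  linarith

/-- Either pooling all types is consistent with the weights, or there is an interval on which the
cumulative weight is between `0` and `κ` and outside of which the first-order effects vanish. -/
theorem exists_pooling_or_interval (h : P.TruncatedMonotone) :
    (∃ t ∈ P.S, P.leftWeight t ≤ 0 ∧ P.rightWeight t ≤ 0) ∨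
    ∃ s₁ ∈ P.S, ∃ s₂ ∈ P.S, s₁ < s₂ ∧ P.leftWeight s₁ = 0 ∧ P.rightWeight s₂ = 0 ∧
      ∀ s ∈ Icc s₁ s₂, 0 ≤ P.cumWeight s ∧ P.cumWeight s ≤ P.κ := by
  by_cases hex : ∃ t ∈ P.S, 0 < P.leftWeight t ∧ 0 < P.rightWeight t
  · right
    obtain ⟨t, ht, hG, hH⟩ := hex
    obtain ⟨p, hp, hneg, hpos⟩ := h.exists_nonpos_nonneg
    obtain ⟨q, hq, hle, hge⟩ := h.exists_le_ge
    have hGle : ∀ u ∈ P.S, u ≤ p → P.leftWeight u ≤ 0 := fun u hu hup => by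
      have : 0 ≤ ∫ s in P.lo..u, -P.cumWeight s := by
        -- The open interval is used because the sign of N at p itself is not known.
        rw [intervalIntegral.integral_of_le hu.1, integral_Ioc_eq_integral_Ioo]
        exact setIntegral_nonneg measurableSet_Ioo fun s hs => neg_nonneg.2
          (hneg s ⟨hs.1.le, hs.2.le.trans hu.2⟩ (hs.2.trans_le hup))
      rw [intervalIntegral.integral_neg] at this
      exact neg_nonneg.1 this
    have hHle : ∀ u ∈ P.S, q ≤ u → P.rightWeight u ≤ 0 := fun u hu hqu => by
      have : 0 ≤ ∫ s in u..P.hi, -(P.κ - P.cumWeight s) := by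
        rw [intervalIntegral.integral_of_le hu.2, integral_Ioc_eq_integral_Ioo]
        refine setIntegral_nonneg measurableSet_Ioo fun s hs => ?_
        linarith [hge s ⟨hu.1.trans hs.1.le, hs.2.le⟩ (hqu.trans_lt hs.1)]
      rw [intervalIntegral.integral_neg] at this
      exact neg_nonneg.1 this
    have hpt : p < t := lt_of_not_ge fun hc => absurd (hGle t ht hc) hG.not_ge
    have htq : t < q := lt_of_not_ge fun hc => absurd (hHle t ht hc) hH.not_ge
    -- G rises from G(p) ≤ 0 to G(t) > 0 and so vanishes in [p, t]; likewise H vanishes in [t, q].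
    obtain ⟨s₁, hs₁, hG₁⟩ := intermediate_value_Icc hpt.le
      (P.leftWeight_continuousOn.mono (Icc_subset_Icc hp.1 ht.2))
      ⟨hGle p hp le_rfl, hG.le⟩
    obtain ⟨s₂, hs₂, hH₂⟩ := intermediate_value_Icc' htq.le
      (P.rightWeight_continuousOn.mono (Icc_subset_Icc ht.1 hq.2))
      ⟨hHle q hq le_rfl, hH.le⟩
    have h1t : s₁ < t := lt_of_le_of_ne hs₁.2 (by rintro rfl; exact hG.ne' hG₁)
    have hlt : s₁ < s₂ := h1t.trans_le hs₂.1
    have hs₁S : s₁ ∈ P.S := ⟨hp.1.trans hs₁.1, hs₁.2.trans ht.2⟩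
    have hs₂S : s₂ ∈ P.S := ⟨ht.1.trans hs₂.1, hs₂.2.trans hq.2⟩
    refine ⟨s₁, hs₁S, s₂, hs₂S, hlt, hG₁, hH₂, fun s hs => ?_⟩
    -- Between p and q the bounds on N hold strictly inside; continuity extends them to the
    -- endpoints.
    rw [← closure_Ioo hlt.ne] at hs
    have hcont : ContinuousOn P.cumWeight (closure (Ioo s₁ s₂)) := by
      rw [closure_Ioo hlt.ne]
      exact P.cumWeight_continuousOn.mono (Icc_subset_Icc hs₁S.1 hs₂S.2)
    have hIoo : Ioo s₁ s₂ ⊆ P.S := fun u hu => ⟨hs₁S.1.trans hu.1.le, hu.2.le.trans hs₂S.2⟩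
    exact ⟨le_on_closure (fun u hu => hpos u (hIoo hu) (hs₁.1.trans_lt hu.1)) continuousOn_const
        hcont hs,
      le_on_closure (fun u hu => hle u (hIoo hu) (hu.2.trans_le hs₂.2)) hcont
        continuousOn_const hs⟩
  · left
    push Not at hex
    have hGlo : P.leftWeight P.lo = 0 := intervalIntegral.integral_same
    have hHhi : P.rightWeight P.hi = 0 := intervalIntegral.integral_same
    rcases le_or_gt (P.rightWeight P.lo) 0 with h1 | h1
    · exact ⟨P.lo, P.lo_mem, hGlo.le, h1⟩
    rcases le_or_gt (P.leftWeight P.hi) 0 with h2 | h2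
    · exact ⟨P.hi, P.hi_mem, h2, hHhi.le⟩
    -- G − H is negative at `lo` and positive at `hi`. Where it vanishes, the common value of G and
    -- H cannot be positive.
    obtain ⟨t, ht, hGH⟩ := intermediate_value_Icc P.lo_lt_hi.le
      (P.leftWeight_continuousOn.sub P.rightWeight_continuousOn)
      (show (0 : ℝ) ∈ Icc (P.leftWeight P.lo - P.rightWeight P.lo)
        (P.leftWeight P.hi - P.rightWeight P.hi) from ⟨by linarith, by linarith⟩)
    have hGH' : P.leftWeight t = P.rightWeight t := sub_eq_zero.1 hGH
    have h3 : P.leftWeight t ≤ 0 := by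
      by_contra hc
      push Not at hc
      exact absurd (hex t ht hc) (by rw [← hGH']; exact hc.not_ge)
    exact ⟨t, ht, h3, hGH' ▸ h3⟩

theorem objective_le_of_pooling (h : P.TruncatedMonotone) {U A : ℝ → ℝ}
    (hUA : IsSubgradientOn U A P.lo P.hi) {t : ℝ} (ht : t ∈ P.S) (hG : P.leftWeight t ≤ 0)
    (hH : P.rightWeight t ≤ 0) :
    P.objective U A ≤ P.κ * U t + A t * (P.rightWeight t - P.leftWeight t) := by
  rw [P.objective_eq hUA ht]
  linarith [h.mul_leftWeight_le hUA.monotoneOn ht hG,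
    h.integral_le_mul_rightWeight hUA.monotoneOn ht hH]

/-- In the decomposition at s₁, each outer term contributes at most 0, and exactly 0 when the slope
is constant there. On [s₁, s₂] the truncation is inactive, so N is increasing, and integration by
parts puts nonnegative weight on V − U. -/
theorem objective_le_of_interval (h : P.TruncatedMonotone) {U A V B : ℝ → ℝ}
    (hUA : IsSubgradientOn U A P.lo P.hi) (hVB : IsSubgradientOn V B P.lo P.hi) {s₁ s₂ : ℝ}
    (hs₁ : s₁ ∈ P.S) (hs₂ : s₂ ∈ P.S) (hlt : s₁ < s₂) (hG : P.leftWeight s₁ = 0)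
    (hH : P.rightWeight s₂ = 0)
    (hN : ∀ s ∈ Icc s₁ s₂, 0 ≤ P.cumWeight s ∧ P.cumWeight s ≤ P.κ)
    (hUV : ∀ s ∈ Icc s₁ s₂, U s ≤ V s) (hB₁ : ∀ s ∈ P.S, s ≤ s₁ → B s = B s₁)
    (hB₂ : ∀ s ∈ P.S, s₂ ≤ s → B s = B s₂) : P.objective U A ≤ P.objective V B := by
  have hsub : Icc s₁ s₂ ⊆ P.S := Icc_subset_Icc hs₁.1 hs₂.2
  have hsplit : ∀ {W C : ℝ → ℝ}, IsSubgradientOn W C P.lo P.hi →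
      ∫ s in s₁..P.hi, (P.κ - P.cumWeight s) * C s =
        (∫ s in s₁..s₂, (P.κ - P.cumWeight s) * C s) +
          ∫ s in s₂..P.hi, (P.κ - P.cumWeight s) * C s := by
    intro W C hW
    have hint : ∀ {x y : ℝ}, x ∈ P.S → y ∈ P.S → x ≤ y →
        IntervalIntegrable (fun s => (P.κ - P.cumWeight s) * C s) volume x y :=
      fun hx hy hxy => (hW.intervalIntegrable hx.1 hxy hy.2).continuousOn_mul
        ((continuousOn_const.sub P.cumWeight_continuousOn).mono (uIcc_subset_Icc hx hy))
    exact (intervalIntegral.integral_add_adjacent_intervals (hint hs₁ hs₂ hlt.le)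
      (hint hs₂ P.hi_mem hs₂.2)).symm
  have hleft : ∫ s in P.lo..s₁, P.cumWeight s * B s = 0 := by
    have : ∫ s in P.lo..s₁, P.cumWeight s * B s = ∫ s in P.lo..s₁, P.cumWeight s * B s₁ := by
      refine intervalIntegral.integral_congr fun s hs => ?_
      rw [uIcc_of_le hs₁.1] at hs
      simp only [hB₁ s ⟨hs.1, hs.2.trans hs₁.2⟩ hs.2]
    rw [this, intervalIntegral.integral_mul_const]
    rw [leftWeight] at hG
    rw [hG, zero_mul]
  have hright : ∫ s in s₂..P.hi, (P.κ - P.cumWeight s) * B s = 0 := by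
    have : ∫ s in s₂..P.hi, (P.κ - P.cumWeight s) * B s =
        ∫ s in s₂..P.hi, (P.κ - P.cumWeight s) * B s₂ := by
      refine intervalIntegral.integral_congr fun s hs => ?_
      rw [uIcc_of_le hs₂.2] at hs
      simp only [hB₂ s ⟨hs₂.1.trans hs.1, hs.2⟩ hs.1]
    rw [this, intervalIntegral.integral_mul_const]
    rw [rightWeight] at hH
    rw [hH, zero_mul]
  have h1 := h.mul_leftWeight_le hUA.monotoneOn hs₁ hG.le
  have h2 := h.integral_le_mul_rightWeight hUA.monotoneOn hs₂ hH.le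
  rw [hG, mul_zero] at h1
  rw [hH, mul_zero] at h2
  have hmono : MonotoneOn P.cumWeight (Icc s₁ s₂) := fun x hx y hy hxy => by
    rcases (hN x hx).1.eq_or_lt with h0 | h0
    · exact h0 ▸ (hN y hy).1
    rcases (hN y hy).2.eq_or_lt with h0' | h0'
    · exact h0' ▸ (hN x hx).2
    exact h x (hsub hx) y (hsub hy) hxy h0 h0'
  have hderiv : ∀ s ∈ Ioo s₁ s₂, HasDerivAt P.cumWeight (P.ν s) s := fun s hs =>
    P.hasDerivAt_cumWeight ⟨hs₁.1.trans_lt hs.1, hs.2.trans_le hs₂.2⟩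
  have hmid := hUA.boundary_le_integral hVB hs₁.1 hlt.le hs₂.2
    (fun s hs => hUV s (Ioo_subset_Icc_self hs))
    (φ := fun s => P.κ - P.cumWeight s) (φ' := fun s => -P.ν s)
    ((continuousOn_const.sub P.cumWeight_continuousOn).mono hsub)
    (fun s hs => (hderiv s hs).const_sub P.κ)
    (fun s hs => by
      have hnhds := Icc_mem_nhds hs.1 hs.2
      have hd := hmono.derivWithin_nonneg (x := s)
      rw [derivWithin_of_mem_nhds hnhds, (hderiv s hs).deriv] at hd
      linarith)
  have e1 : s₁ ∈ Icc s₁ s₂ := ⟨le_rfl, hlt.le⟩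
  have e2 : s₂ ∈ Icc s₁ s₂ := ⟨hlt.le, le_rfl⟩
  have h3 : 0 ≤ (P.κ - P.cumWeight s₂) * (V s₂ - U s₂) :=
    mul_nonneg (sub_nonneg.2 (hN _ e2).2) (sub_nonneg.2 (hUV _ e2))
  -- The weight at s₁ is κ from the term κU(s₁) less κ − N(s₁) from the integration by parts.
  have h4 : 0 ≤ P.cumWeight s₁ * (V s₁ - U s₁) :=
    mul_nonneg (hN _ e1).1 (sub_nonneg.2 (hUV _ e1))
  rw [P.objective_eq hUA hs₁, P.objective_eq hVB hs₁, hsplit hUA, hsplit hVB, hleft, hright]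
  linarith

end TruncatedMonotone

end DelegationProblem

/-! ### First-best actions and delegation mechanisms -/

namespace DelegationProblem

variable (P : DelegationProblem)

theorem exists_isFirstBest (s : ℝ) : ∃ a, P.IsFirstBest a s := by
  have hcont : Continuous fun a => P.uA a s :=
    (continuous_id.mul continuous_const).add P.b_differentiable.continuous
  refine hcont.exists_forall_ge ?_
  rw [← Metric.cobounded_eq_cocompact]
  have hnorm := tendsto_norm_cobounded_atTop (E := ℝ)
  refine tendsto_atBot_mono' _ ?_ (tendsto_neg_atTop_atBot.comp hnorm)
  -- The slope |s| absorbs the linear term a·s; the extra 1 leaves the coercive bound −|a|.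
  filter_upwards [P.b_limit.eventually_le_atBot (-(|s| + 1)), hnorm.eventually_gt_atTop 0]
    with a ha hpos
  rw [div_le_iff₀ hpos] at ha
  have h1 : a * s ≤ ‖a‖ * |s| := (le_abs_self _).trans_eq (abs_mul _ _)
  simp only [uA, Function.comp_apply]
  linarith

/-- A first-best action of the number `s`. -/
noncomputable def best (s : ℝ) : ℝ := (P.exists_isFirstBest s).choose

theorem best_isFirstBest (s : ℝ) : P.IsFirstBest (P.best s) s := (P.exists_isFirstBest s).choose_spec

variable {P}

theorem IsFirstBest.eq {a a' s : ℝ} (h : P.IsFirstBest a s) (h' : P.IsFirstBest a' s) : a = a' := by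
  have hconc : StrictConcaveOn ℝ univ fun a => a * s + P.b a := by
    have hlin : ConcaveOn ℝ univ fun a : ℝ => a * s :=
      (LinearMap.mulRight ℝ s).concaveOn convex_univ
    exact hlin.add_strictConcaveOn P.b_strictConcave
  exact hconc.eq_of_isMaxOn (fun x _ => h x) (fun x _ => h' x) (mem_univ _) (mem_univ _)

theorem IsFirstBest.mono {a a' s t : ℝ} (h : P.IsFirstBest a s) (h' : P.IsFirstBest a' t)
    (hst : s ≤ t) : a ≤ a' := by
  rcases hst.eq_or_lt with rfl | hlt
  · exact (h.eq h').le
  have h1 := h a'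
  have h2 := h' a
  simp only [uA] at h1 h2
  by_contra hc
  nlinarith [mul_pos (sub_pos.2 hlt) (sub_pos.2 (not_le.1 hc))]

variable (P)

/-- The most preferred action of type `s` among the first-best actions of `[s₁, s₂]`. -/
noncomputable def delegated (s₁ s₂ s : ℝ) : ℝ := P.best (max s₁ (min s s₂))

theorem delegated_of_mem {s₁ s₂ s : ℝ} (hs : s ∈ Icc s₁ s₂) : P.delegated s₁ s₂ s = P.best s := by
  rw [delegated, min_eq_left hs.2, max_eq_right hs.1]

theorem delegated_of_le {s₁ s₂ s : ℝ} (h : s₁ ≤ s₂) (hs : s ≤ s₁) :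
    P.delegated s₁ s₂ s = P.best s₁ := by
  rw [delegated, min_eq_left (hs.trans h), max_eq_left hs]

theorem delegated_of_ge {s₁ s₂ s : ℝ} (h : s₁ ≤ s₂) (hs : s₂ ≤ s) :
    P.delegated s₁ s₂ s = P.best s₂ := by
  rw [delegated, min_eq_right hs, max_eq_right h]

theorem delegated_mem_menu {s₁ s₂ : ℝ} (h : s₁ ≤ s₂) (s : ℝ) :
    P.delegated s₁ s₂ s ∈ P.menu (Icc s₁ s₂) :=
  ⟨_, ⟨le_max_left _ _, max_le h (min_le_right _ _)⟩, P.best_isFirstBest _⟩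

/-- Single crossing: s₁ prefers her own first-best, the lowest action on the menu, so lower types
prefer it even more strongly; symmetrically above s₂. -/
theorem uA_le_delegated {s₁ s₂ : ℝ} (h : s₁ ≤ s₂) {a : ℝ} (ha : a ∈ P.menu (Icc s₁ s₂)) (s : ℝ) :
    P.uA a s ≤ P.uA (P.delegated s₁ s₂ s) s := by
  obtain ⟨t, ht, hat⟩ := ha
  rcases lt_or_ge s s₁ with hs | hs
  · rw [P.delegated_of_le h hs.le]
    have h1 := (P.best_isFirstBest s₁).mono hat ht.1
    have h2 := P.best_isFirstBest s₁ a
    simp only [uA] at h2 ⊢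
    nlinarith [mul_nonneg (sub_nonneg.2 h1) (sub_nonneg.2 hs.le)]
  rcases lt_or_ge s₂ s with hs' | hs'
  · rw [P.delegated_of_ge h hs'.le]
    have h1 := hat.mono (P.best_isFirstBest s₂) ht.2
    have h2 := P.best_isFirstBest s₂ a
    simp only [uA] at h2 ⊢
    nlinarith [mul_nonneg (sub_nonneg.2 h1) (sub_nonneg.2 hs'.le)]
  · rw [P.delegated_of_mem ⟨hs, hs'⟩]
    exact P.best_isFirstBest s a

/-- The indirect utility from a menu of first-best actions. -/
noncomputable def delegatedUtility (s₁ s₂ s : ℝ) : ℝ := P.uA (P.delegated s₁ s₂ s) s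

theorem isSubgradientOn_delegated {s₁ s₂ : ℝ} (h : s₁ ≤ s₂) :
    IsSubgradientOn (P.delegatedUtility s₁ s₂) (P.delegated s₁ s₂) P.lo P.hi := fun s _ t _ => by
  have := P.uA_le_delegated h (P.delegated_mem_menu h s) t
  simp only [delegatedUtility]
  refine le_trans (le_of_eq ?_) this
  simp only [uA]
  ring

/-- The mechanism in which the agent chooses from the first-best actions of `[s₁, s₂]`. -/
noncomputable def delegation (s₁ s₂ s : ℝ) : ProbabilityMeasure ℝ := sure (P.delegated s₁ s₂ s)

theorem agentPayoff_sure (a s : ℝ) : P.agentPayoff (sure a) s = P.uA a s := by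
  simp [agentPayoff, sure]

theorem principalPayoff_sure (a s : ℝ) : P.principalPayoff (sure a) s = P.uP a s := by
  simp [principalPayoff, sure]

theorem principalPayoff_delegation (s₁ s₂ s : ℝ) :
    P.principalPayoff (P.delegation s₁ s₂ s) s = P.κ * P.delegatedUtility s₁ s₂ s +
      (P.g s - P.κ * s) * P.delegated s₁ s₂ s := by
  rw [delegation, principalPayoff_sure, delegatedUtility, uA, uP]
  ring

theorem isMechanism_delegation {s₁ s₂ : ℝ} (h : s₁ ≤ s₂) :
    P.IsMechanism (P.delegation s₁ s₂) := by
  have hsub := P.isSubgradientOn_delegated h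
  have hu : uIcc P.lo P.hi = Icc P.lo P.hi := uIcc_of_le P.lo_lt_hi.le
  have hU : IntervalIntegrable (P.delegatedUtility s₁ s₂) volume P.lo P.hi := by
    apply ContinuousOn.intervalIntegrable
    rw [hu]
    exact hsub.continuousOn
  refine ⟨fun s _ => ?_, fun s _ => ?_, ?_, ?_⟩
  · exact integrable_dirac (by simp)
  · exact integrable_dirac (by simp)
  · simp only [delegation, agentPayoff_sure]
    exact P.integrable_law hU
  · simp only [principalPayoff_delegation]
    refine P.integrable_law ((hU.const_mul _).add ?_)
    apply (hsub.intervalIntegrable le_rfl P.lo_lt_hi.le le_rfl).continuousOn_mul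
    rw [hu]
    exact P.g_continuous.sub (continuousOn_const.mul continuousOn_id)

theorem incentiveCompatible_delegation {s₁ s₂ : ℝ} (h : s₁ ≤ s₂) :
    P.IncentiveCompatible (P.delegation s₁ s₂) := fun s _ s' _ => by
  simp only [delegation, agentPayoff_sure]
  exact P.uA_le_delegated h (P.delegated_mem_menu h s') s

theorem value_delegation (s₁ s₂ : ℝ) : P.value (P.delegation s₁ s₂) =
    P.objective (P.delegatedUtility s₁ s₂) (P.delegated s₁ s₂) := by
  rw [value, integral_law, objective]
  simp only [principalPayoff_delegation]

theorem delegatesTo_delegation {s₁ s₂ : ℝ} (h : s₁ ≤ s₂) :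
    P.DelegatesTo (Icc s₁ s₂) (P.delegation s₁ s₂) := by
  refine ⟨fun s _ hs => ⟨P.best s, P.best_isFirstBest s, ?_⟩, fun s _ _ =>
    ⟨_, P.delegated_mem_menu h s, fun a ha => P.uA_le_delegated h ha s, rfl⟩⟩
  rw [delegation, P.delegated_of_mem hs]

/-! ### Arbitrary stochastic mechanisms and the comparison with delegation -/

/-- The expected action of a lottery. -/
noncomputable def meanAction (p : ProbabilityMeasure ℝ) : ℝ := ∫ a, a ∂(p : Measure ℝ)

variable {P}

theorem IsMechanism.integrable_uA {m : ℝ → ProbabilityMeasure ℝ} (hm : P.IsMechanism m) {s : ℝ}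
    (hs : s ∈ P.S) (r : ℝ) : Integrable (fun a => P.uA a r) (m s : Measure ℝ) :=
  ((hm.integrable_action s hs).mul_const r).add (hm.integrable_b s hs)

/-- A lottery matters only through its means of a and b(a), and the payoff is affine in the type r,
which may lie outside S. -/
theorem IsMechanism.agentPayoff_eq {m : ℝ → ProbabilityMeasure ℝ} (hm : P.IsMechanism m) {s : ℝ}
    (hs : s ∈ P.S) (r : ℝ) :
    P.agentPayoff (m s) r = meanAction (m s) * r + ∫ a, P.b a ∂(m s : Measure ℝ) := by
  simp only [agentPayoff, uA, meanAction]
  rw [integral_add ((hm.integrable_action s hs).mul_const r) (hm.integrable_b s hs),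
    integral_mul_const]

theorem IsMechanism.principalPayoff_eq {m : ℝ → ProbabilityMeasure ℝ} (hm : P.IsMechanism m)
    {s : ℝ} (hs : s ∈ P.S) : P.principalPayoff (m s) s =
      P.κ * P.agentPayoff (m s) s + (P.g s - P.κ * s) * meanAction (m s) := by
  rw [hm.agentPayoff_eq hs]
  simp only [principalPayoff, uP, meanAction]
  rw [integral_add ((hm.integrable_action s hs).mul_const _)
    ((hm.integrable_b s hs).const_mul P.κ), integral_mul_const, integral_const_mul]
  ring

theorem IsMechanism.agentPayoff_le {m : ℝ → ProbabilityMeasure ℝ} (hm : P.IsMechanism m) {s : ℝ}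
    (hs : s ∈ P.S) (r : ℝ) : P.agentPayoff (m s) r ≤ P.uA (P.best r) r := by
  have h := integral_mono (hm.integrable_uA hs r) (integrable_const (P.uA (P.best r) r))
    (fun a => P.best_isFirstBest r a)
  simpa [agentPayoff] using h

theorem IsMechanism.isSubgradientOn {m : ℝ → ProbabilityMeasure ℝ} (hm : P.IsMechanism m)
    (hic : P.IncentiveCompatible m) :
    IsSubgradientOn (fun s => P.agentPayoff (m s) s) (fun s => meanAction (m s)) P.lo P.hi := by
  intro s hs t ht
  have h := hic t ht s hs
  rw [hm.agentPayoff_eq hs t] at h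
  simp only [hm.agentPayoff_eq hs s]
  linarith

theorem IsMechanism.value_eq {m : ℝ → ProbabilityMeasure ℝ} (hm : P.IsMechanism m) :
    P.value m = P.objective (fun s => P.agentPayoff (m s) s) fun s => meanAction (m s) := by
  rw [value, integral_law, objective]
  refine intervalIntegral.integral_congr fun s hs => ?_
  rw [uIcc_of_le P.lo_lt_hi.le] at hs
  simp only [hm.principalPayoff_eq hs]

theorem delegationOptimal_of_value_le {s₁ s₂ : ℝ} (h : s₁ ≤ s₂)
    (hle : ∀ m, P.IsMechanism m → P.IncentiveCompatible m →
      P.objective (fun s => P.agentPayoff (m s) s) (fun s => meanAction (m s)) ≤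
        P.objective (P.delegatedUtility s₁ s₂) (P.delegated s₁ s₂)) :
    P.DelegationOptimal (Icc s₁ s₂) := by
  refine ⟨P.delegation s₁ s₂, ⟨P.isMechanism_delegation h, P.incentiveCompatible_delegation h,
    fun m hm hic => ?_⟩, P.delegatesTo_delegation h⟩
  rw [hm.value_eq, value_delegation]
  exact hle m hm hic

theorem TruncatedMonotone.delegationOptimal_singleton (h : P.TruncatedMonotone) {t : ℝ}
    (ht : t ∈ P.S) (hG : P.leftWeight t ≤ 0) (hH : P.rightWeight t ≤ 0) :
    ∃ r, P.DelegationOptimal (Icc r r) := by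
  -- With this r the pooling bound is κ times the payoff of a hypothetical type r from the lottery
  -- of t. It is at most κ times her first-best payoff, which the constant action `P.best r`
  -- attains.
  obtain ⟨r, hr⟩ : ∃ r, P.κ * (r - t) = P.rightWeight t - P.leftWeight t :=
    ⟨t + (P.rightWeight t - P.leftWeight t) / P.κ, by
      rw [add_sub_cancel_left, mul_div_cancel₀ _ P.κ_pos.ne']⟩
  refine ⟨r, delegationOptimal_of_value_le le_rfl fun m hm hic => ?_⟩
  have h1 := h.objective_le_of_pooling (hm.isSubgradientOn hic) ht hG hH
  have h2 := mul_le_mul_of_nonneg_left (hm.agentPayoff_le ht r) P.κ_pos.le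
  have hconst : P.delegated r r = fun _ => P.best r := funext fun s => by
    rcases le_total s r with hs | hs
    · exact P.delegated_of_le le_rfl hs
    · exact P.delegated_of_ge le_rfl hs
  rw [P.objective_eq (P.isSubgradientOn_delegated le_rfl) ht]
  simp only [delegatedUtility, hconst, intervalIntegral.integral_mul_const]
  change _ ≤ P.κ * P.uA (P.best r) t - P.leftWeight t * P.best r + P.rightWeight t * P.best r
  rw [hm.agentPayoff_eq ht] at h1 h2
  rw [← hr] at h1
  simp only [uA] at h2 ⊢
  linear_combination h1 + h2 + P.best r * hr

theorem TruncatedMonotone.delegationOptimal_Icc (h : P.TruncatedMonotone) {s₁ s₂ : ℝ}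
    (hs₁ : s₁ ∈ P.S) (hs₂ : s₂ ∈ P.S) (hlt : s₁ < s₂) (hG : P.leftWeight s₁ = 0)
    (hH : P.rightWeight s₂ = 0)
    (hN : ∀ s ∈ Icc s₁ s₂, 0 ≤ P.cumWeight s ∧ P.cumWeight s ≤ P.κ) :
    P.DelegationOptimal (Icc s₁ s₂) := by
  refine delegationOptimal_of_value_le hlt.le fun m hm hic => ?_
  refine h.objective_le_of_interval (hm.isSubgradientOn hic) (P.isSubgradientOn_delegated hlt.le)
    hs₁ hs₂ hlt hG hH hN (fun s hs => ?_) (fun s _ hs => ?_) (fun s _ hs => ?_)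
  · rw [delegatedUtility, P.delegated_of_mem hs]
    exact hm.agentPayoff_le ⟨hs₁.1.trans hs.1, hs.2.trans hs₂.2⟩ s
  · rw [P.delegated_of_le hlt.le hs, P.delegated_of_le hlt.le le_rfl]
  · rw [P.delegated_of_ge hlt.le hs, P.delegated_of_ge hlt.le le_rfl]

end DelegationProblem

theorem corollary2 (P : DelegationProblem)
    (hν : Set.OrdConnected {s : ℝ | s ∈ P.S ∧ 0 ≤ P.ν s}) :
    ∃ s₁ s₂ : ℝ, s₁ ≤ s₂ ∧ ((s₁ ∈ P.S ∧ s₂ ∈ P.S) ∨ s₁ = s₂) ∧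
      P.DelegationOptimal (Set.Icc s₁ s₂) := by
  have h : P.TruncatedMonotone := fun _ hx _ hy hxy h0 hκ =>
    P.cumWeight_le_of_ordConnected hν hx hy hxy h0 hκ
  rcases h.exists_pooling_or_interval with ⟨t, ht, hG, hH⟩ |
    ⟨s₁, hs₁, s₂, hs₂, hlt, hG, hH, hN⟩
  · obtain ⟨r, hr⟩ := h.delegationOptimal_singleton ht hG hH
    exact ⟨r, r, le_rfl, Or.inr rfl, hr⟩
  · exact ⟨s₁, s₂, hlt.le, Or.inl ⟨hs₁, hs₂⟩, h.delegationOptimal_Icc hs₁ hs₂ hlt hG hH hN⟩
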